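/- Let $\mathbf F=\mathbb C((t))$, $\mathbf O=\mathbb C[[t]]$. Let $v_1,\dots,v_6$ be a basis of $\mathbb C^6$ with the symplectic form $\langle v_i,v_{7-i}\rangle=1=-\langle v_{7-i},v_i\rangle$ for $i=1,2,3$, all other pairings being $0$, and let $\mathrm{PSp}(6)=\mathrm{GSp}(6)/\mathbb G_m$ be the corresponding projective symplectic group. Set $\overline G=\mathrm{PGL}(2)\times\mathrm{PSp}(6)$ and $\mathrm{Gr}_{\overline G}=\overline G(\mathbf F)/\overline G(\mathbf O)$. Embed $\mathrm{PGL}(2)$ in $\mathrm{PSp}(6)$ by $\iota\begin{pmatrix}a&b\\c&d\end{pmatrix}=\mathrm{diag}\left(\begin{pmatrix}a&b\\c&d\end{pmatrix},\begin{pmatrix}a&b\\c&d\end{pmatrix},\begin{pmatrix}a&-b\\-c&d\end{pmatrix}\right)$, let $\mathrm U\subset\mathrm{PSp}(6)$ be the unipotent radical of the stabilizer of $\langle v_1,v_2\rangle$, and let $H=\mathrm{PGL}(2)\ltimes\mathrm U$, embedded in $\overline G$ by $A\mapsto(A,\iota(A))$ for $A\in\mathrm{PGL}(2)$ and $u\mapsto(1,u)$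 for $u\in\mathrm U$. Let $g\in\mathrm{PSp}(6)$ be the class of $\mathrm{Id}+E_{34}$. Let $U_{\mathrm{PGL}(2)}$ be the group of upper triangular unipotent matrices in $\mathrm{PGL}(2)$, $U^-_{\mathrm{PSp}(6)}$ the group of lower triangular unipotent matrices in $\mathrm{PSp}(6)$, and $U=U_{\mathrm{PGL}(2)}\times gU^-_{\mathrm{PSp}(6)}g^{-1}$. Let $X$ be the set of $\lambda=(\lambda_1,\lambda_2,\lambda_3,\lambda_4)\in(\frac12\mathbb Z)^4$ with $\lambda_1-\lambda_2,\ \lambda_2-\lambda_3\in\mathbb Z$. For $\lambda\in X$ write $t^{(\lambda_1,\lambda_2,\lambda_3)}\in\mathrm{PSp}(6,\mathbf F)$ for the class of $\mathrm{diag}(t^{\lambda_1},t^{\lambda_2},t^{\lambda_3},t^{-\lambda_3},t^{-\lambda_2},t^{-\lambda_1})$ and, for $s\in\frac12\mathbb Z$, write $t^{s}\in\mathrm{PGL}(2,\mathbf F)$ for the class of $\mathrm{diag}(t^{s},t^{-s})$, i.e. of $\mathrm{diag}(t^{2s},1)$ (if the exponents of the first matrix are half-integers, it is multiplied by the scalar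 $t^{1/2}$). For $\lambda\in X$ with $\lambda_1\ge\lambda_2$, $\lambda_3\ge0$, $\lambda_4\ge0$ let $\mathcal O^\lambda\subset\mathrm{Gr}_{\overline G}$ be the $H(\mathbf F)$-orbit of the point $(1,\iota(t^{\lambda_4})\,g\,t^{(\lambda_1,\lambda_2,\lambda_3)})$. For $\mu\in X$ let $\mathcal S^\mu\subset\mathrm{Gr}_{\overline G}$ be the $U(\mathbf F)$-orbit of the point $(t^{-\mu_4},\,g\,t^{(\mu_1,\mu_2,\mu_3)})$. Proposition. If $\mathcal O^\lambda\cap\mathcal S^\mu\ne\emptyset$, then $\mu\le\lambda$, that is, $\lambda-\mu=a_1\alpha_1+a_2\alpha_2+a_3\alpha_3+a_4\alpha_4$ with nonnegative integers $a_i$, where $\alpha_1=\frac12(1,-1,-1,1)$, $\alpha_2=\frac12(-1,1,1,1)$, $\alpha_3=\frac12(1,-1,1,-1)$, $\alpha_4=(0,1,-1,0)$ are the simple roots of $\mathfrak f(4)$. -/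

import Mathlib

open scoped Matrix MatrixGroups LaurentSeries PowerSeries

namespace GaiottoF4

/-! ### The projective symplectic group in six variables -/

section Symplectic

variable (R : Type*) [CommRing R]

/-- Gram matrix of the symplectic form on `R⁶`: in the basis `v₁, …, v₆` (indexed by `0, …, 5`)
one has `⟨vᵢ, v₇₋ᵢ⟩ = 1 = -⟨v₇₋ᵢ, vᵢ⟩` for `i = 1, 2, 3`, and all other pairings vanish. -/
def form : Matrix (Fin 6) (Fin 6) R :=
  Matrix.of fun i j => if i.val + j.val = 5 then (if i.val < 3 then 1 else -1) else 0

/-- The group `GSp(6, R)` of symplectic similitudes. -/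
def GSp6 : Subgroup (GL (Fin 6) R) where
  carrier := {M | ∃ c : Rˣ, M.valᵀ * form R * M.val = (c : R) • form R}
  one_mem' := ⟨1, by simp⟩
  mul_mem' := by
    rintro M N ⟨c, hc⟩ ⟨d, hd⟩
    refine ⟨c * d, ?_⟩
    calc (M * N).valᵀ * form R * (M * N).val
        = N.valᵀ * (M.valᵀ * form R * M.val) * N.val := by
          simp [Matrix.transpose_mul, Matrix.mul_assoc]
      _ = _ := by
          rw [hc, Matrix.mul_smul, Matrix.smul_mul, hd, smul_smul, Units.val_mul]
  inv_mem' := by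
    rintro M ⟨c, hc⟩
    refine ⟨c⁻¹, ?_⟩
    have h1 : M.val * M⁻¹.val = 1 := by simp
    have h2 : M⁻¹.valᵀ * M.valᵀ = 1 := by rw [← Matrix.transpose_mul, h1, Matrix.transpose_one]
    have h3 : M⁻¹.valᵀ * ((c : R) • form R) * M⁻¹.val = form R := by
      rw [← hc]
      calc M⁻¹.valᵀ * (M.valᵀ * form R * M.val) * M⁻¹.val
          = (M⁻¹.valᵀ * M.valᵀ) * form R * (M.val * M⁻¹.val) := by
            simp only [Matrix.mul_assoc]
        _ = form R := by rw [h1, h2, Matrix.one_mul, Matrix.mul_one]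
    rw [Matrix.mul_smul, Matrix.smul_mul] at h3
    calc M⁻¹.valᵀ * form R * M⁻¹.val
        = ((c⁻¹ : Rˣ) : R) • ((c : R) • (M⁻¹.valᵀ * form R * M⁻¹.val)) := by
          rw [smul_smul, Units.inv_mul, one_smul]
      _ = _ := by rw [h3]

/-- `PSp(6, R) = GSp(6, R) / Rˣ`, the quotient by the scalar matrices (these form the centre of
`GL(6, R)`). For the rings used below, the field of Laurent series and the ring of power series,
every line bundle is trivial, so this is the group of `R`-points of the algebraic group
`PSp(6) = GSp(6) / 𝔾ₘ = Sp(6) / {±1}`. -/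
abbrev PSp6 : Type _ := GSp6 R ⧸ (Subgroup.center (GL (Fin 6) R)).subgroupOf (GSp6 R)

/-- The projection `GSp(6, R) → PSp(6, R)`. -/
abbrev PSp6.mk : GSp6 R →* PSp6 R :=
  QuotientGroup.mk' ((Subgroup.center (GL (Fin 6) R)).subgroupOf (GSp6 R))

/-- The matrix homomorphism `A ↦ diag(A, A, A')` with
`A = (a b; c d)` and `A' = (a -b; -c d)`. -/
def iotaMatrix : Matrix (Fin 2) (Fin 2) R →* Matrix (Fin 6) (Fin 6) R where
  toFun A :=
    !![A 0 0, A 0 1, 0, 0, 0, 0;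
       A 1 0, A 1 1, 0, 0, 0, 0;
       0, 0, A 0 0, A 0 1, 0, 0;
       0, 0, A 1 0, A 1 1, 0, 0;
       0, 0, 0, 0, A 0 0, -A 0 1;
       0, 0, 0, 0, -A 1 0, A 1 1]
  map_one' := by
    ext i j
    fin_cases i <;> fin_cases j <;> simp
  map_mul' A B := by
    ext i j
    fin_cases i <;> fin_cases j <;>
      simp [Matrix.mul_apply, Fin.sum_univ_six, Fin.sum_univ_two, add_comm]

lemma iotaMatrix_form (A : Matrix (Fin 2) (Fin 2) R) :
    (iotaMatrix R A)ᵀ * form R * iotaMatrix R A = A.det • form R := by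
  have hJ : form R = !![0, 0, 0, 0, 0, 1; 0, 0, 0, 0, 1, 0; 0, 0, 0, 1, 0, 0;
      0, 0, -1, 0, 0, 0; 0, -1, 0, 0, 0, 0; -1, 0, 0, 0, 0, 0] := by
    ext i j
    fin_cases i <;> fin_cases j <;> simp [form]
  rw [hJ, Matrix.det_fin_two]
  ext i j
  fin_cases i <;> fin_cases j <;>
    simp [iotaMatrix, Matrix.mul_apply, Fin.sum_univ_six] <;> ring

/-- The diagonal embedding of `GL(2)` in the Levi subgroup of `GSp(6)` stabilizing
`⟨v₁, v₂⟩` and `⟨v₅, v₆⟩`: the standard action on `⟨v₁, v₂⟩` and on `⟨v₃, v₄⟩`, and therefore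
`A' = det(A) · (dual of A)` on `⟨v₅, v₆⟩`. It fixes the functional `u₁₃ + u₂₄`. -/
def iotaGL : GL (Fin 2) R →* GSp6 R :=
  (Units.map (iotaMatrix R)).codRestrict (GSp6 R) fun A =>
    ⟨Matrix.GeneralLinearGroup.det A, iotaMatrix_form R A.val⟩

lemma iotaGL_scalar (u : Rˣ) :
    (iotaGL R (Matrix.GeneralLinearGroup.scalar (Fin 2) u) : GL (Fin 6) R) =
      Matrix.GeneralLinearGroup.scalar (Fin 6) u := by
  ext i j
  fin_cases i <;> fin_cases j <;> simp [iotaGL, iotaMatrix]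

/-- The embedding `PGL(2) → PSp(6)` induced by the diagonal embedding of `GL(2)`. -/
def iota : PGL(2, R) →* PSp6 R :=
  QuotientGroup.lift (Subgroup.center (GL (Fin 2) R)) ((PSp6.mk R).comp (iotaGL R)) (by
    intro A hA
    rw [Matrix.GeneralLinearGroup.center_eq_range_scalar] at hA
    obtain ⟨u, rfl⟩ := hA
    rw [MonoidHom.mem_ker, MonoidHom.comp_apply, QuotientGroup.mk'_apply,
      QuotientGroup.eq_one_iff, Subgroup.mem_subgroupOf, iotaGL_scalar,
      Matrix.GeneralLinearGroup.center_eq_range_scalar]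
    exact ⟨u, rfl⟩)

end Symplectic

/-! ### Unipotent subgroups -/

/-- Given a weight function `b` on the indices, the group of matrices that are block upper
triangular with respect to `b` and have identity diagonal blocks, i.e. the unipotent radical of the
parabolic subgroup of `GL(n)` defined by `b`. -/
def unipotent {n : Type*} [Fintype n] [DecidableEq n] (R : Type*) [CommRing R] (b : n → ℤ) :
    Subgroup (GL n R) where
  carrier := {M | ∀ i j, b j ≤ b i → M.val i j = (1 : Matrix n n R) i j}
  one_mem' := by intro i j _; rfl
  mul_mem' := by
    intro M N hM hN i j hij
    rw [Units.val_mul, Matrix.mul_apply, Finset.sum_eq_single i]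
    · rw [hM i i le_rfl, hN i j hij, Matrix.one_apply_eq, one_mul]
    · intro k _ hk
      rcases le_or_gt (b k) (b i) with h | h
      · rw [hM i k h, Matrix.one_apply_ne hk.symm, zero_mul]
      · rw [hN k j (hij.trans h.le)]
        rcases eq_or_ne k j with rfl | hkj
        · exact absurd hij (not_le.mpr h)
        · rw [Matrix.one_apply_ne hkj, mul_zero]
    · simp
  inv_mem' := by
    intro M hM i j hij
    have hT : Matrix.BlockTriangular M.val b := by
      intro i j h
      rw [hM i j h.le, Matrix.one_apply_ne]
      rintro rfl
      exact lt_irrefl _ h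
    have hT' : Matrix.BlockTriangular M⁻¹.val b := by
      let _ := M.invertible
      have := Matrix.blockTriangular_inv_of_blockTriangular hT
      rwa [Matrix.coe_units_inv]
    have key : (M⁻¹.val * M.val) i j = M⁻¹.val i j := by
      rw [Matrix.mul_apply, Finset.sum_eq_single j]
      · rw [hM j j le_rfl, Matrix.one_apply_eq, mul_one]
      · intro k _ hk
        rcases lt_or_ge (b k) (b i) with h | h
        · rw [hT' h, zero_mul]
        · rw [hM k j (hij.trans h), Matrix.one_apply_ne hk, mul_zero]
      · simp
    rw [← key, Units.inv_mul]

/-! ### The affine Grassmannian of `PGL(2) × PSp(6)` -/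

/-- The field `𝕂 = ℂ((t))`. -/
abbrev 𝕂 : Type := ℂ⸨X⸩

/-- The ring `𝕆 = ℂ[[t]]`. -/
abbrev 𝕆 : Type := ℂ⟦X⟧

/-- The group of `𝕂`-points of `PGL(2) × PSp(6)`. -/
abbrev GF : Type := PGL(2, 𝕂) × PSp6 𝕂

/-- `PGL(2, 𝕆)`, as a subgroup of `PGL(2, 𝕂)`: the image of `GL(2, 𝕆)`. -/
noncomputable def PGL2O : Subgroup PGL(2, 𝕂) :=
  (Matrix.GeneralLinearGroup.map (n := Fin 2) (algebraMap 𝕆 𝕂)).range.map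
    Matrix.ProjGenLinGroup.mk

/-- `PSp(6, 𝕆)`, as a subgroup of `PSp(6, 𝕂)`: the image of `GSp(6, 𝕆)`. -/
noncomputable def PSp6O : Subgroup (PSp6 𝕂) :=
  ((((GSp6 𝕆).map (Matrix.GeneralLinearGroup.map (algebraMap 𝕆 𝕂)))).subgroupOf
    (GSp6 𝕂)).map (PSp6.mk 𝕂)

/-- The set of `ℂ`-points of the affine Grassmannian of `PGL(2) × PSp(6)`. -/
abbrev Gr : Type := GF ⧸ (PGL2O.prod PSp6O)

/-- `U(𝕂)`, for `U` the unipotent radical of the parabolic subgroup of `PSp(6)` stabilizing the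
isotropic plane `⟨v₁, v₂⟩`; the blocks are `{v₁, v₂}`, `{v₃, v₄}`, `{v₅, v₆}`. -/
noncomputable def UF : Subgroup (PSp6 𝕂) :=
  ((unipotent 𝕂 fun i : Fin 6 => ((i.val / 2 : ℕ) : ℤ)).subgroupOf (GSp6 𝕂)).map (PSp6.mk 𝕂)

/-- `H(𝕂)`, for `H = PGL(2) ⋉ U` embedded in `PGL(2) × PSp(6)`: it is generated by the elements
`(A, ι(A))` and `(1, u)` with `u ∈ U(𝕂)`. -/
noncomputable def HF : Subgroup GF :=
  ((MonoidHom.id PGL(2, 𝕂)).prod (iota 𝕂)).range ⊔ (⊥ : Subgroup PGL(2, 𝕂)).prod UF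

/-- The `𝕂`-points of the unipotent radical of the upper triangular Borel subgroup of `PGL(2)`. -/
noncomputable def UPGL2F : Subgroup PGL(2, 𝕂) :=
  (unipotent 𝕂 fun i : Fin 2 => (i.val : ℤ)).map Matrix.ProjGenLinGroup.mk

/-- The `𝕂`-points of the unipotent radical of the lower triangular Borel subgroup of `PSp(6)`. -/
noncomputable def UminusPSp6F : Subgroup (PSp6 𝕂) :=
  ((unipotent 𝕂 fun i : Fin 6 => -(i.val : ℤ)).subgroupOf (GSp6 𝕂)).map (PSp6.mk 𝕂)

/-- The matrix `Id + E₃₄` as an element of `GSp(6, 𝕂)`. -/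
noncomputable def gGSp : GSp6 𝕂 :=
  ⟨⟨Matrix.transvection 2 3 1, Matrix.transvection 2 3 (-1),
      by rw [Matrix.transvection_mul_transvection_same _ _ (by decide)]; simp,
      by rw [Matrix.transvection_mul_transvection_same _ _ (by decide)]; simp⟩,
    1, by
      ext i j
      fin_cases i <;> fin_cases j <;>
        simp [form, Matrix.transvection, Matrix.mul_apply, Fin.sum_univ_succ,
          Matrix.single_apply, Matrix.one_apply]⟩

/-- The element `g = Id + E₃₄` of `PSp(6, 𝕂)`. -/
noncomputable def g : PSp6 𝕂 := PSp6.mk 𝕂 gGSp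

/-- `U_B(𝕂)`, for `U_B` the unipotent radical of the Borel subgroup
`B_{PGL(2)} × g B⁻_{PSp(6)} g⁻¹` of `PGL(2) × PSp(6)`. -/
noncomputable def UBF : Subgroup GF :=
  UPGL2F.prod (UminusPSp6F.map (MulAut.conj g).toMonoidHom)

/-! ### Coweights -/

/-- The uniformizer `t`, as a unit of `𝕂`. -/
noncomputable def t : 𝕂ˣ :=
  Units.mk0 (HahnSeries.single 1 1) (HahnSeries.single_ne_zero one_ne_zero)

/-- The invertible diagonal matrix with entries `t ^ e i`. -/
noncomputable def tDiag {n : ℕ} (e : Fin n → ℤ) : GL (Fin n) 𝕂 where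
  val := Matrix.diagonal fun i => ((t ^ e i : 𝕂ˣ) : 𝕂)
  inv := Matrix.diagonal fun i => (((t ^ e i)⁻¹ : 𝕂ˣ) : 𝕂)
  val_inv := by
    rw [Matrix.diagonal_mul_diagonal, ← Matrix.diagonal_one]
    exact congrArg _ (funext fun i => Units.mul_inv _)
  inv_val := by
    rw [Matrix.diagonal_mul_diagonal, ← Matrix.diagonal_one]
    exact congrArg _ (funext fun i => Units.inv_mul _)

/-- The similitude `diag(t^(p+m), t^(q+m), t^m, 1, t^(-q), t^(-p))`. -/
noncomputable def tGSp (p q m : ℤ) : GSp6 𝕂 :=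
  ⟨tDiag ![p + m, q + m, m, 0, -q, -p], t ^ m, by
    ext i j
    rw [tDiag, Matrix.diagonal_transpose, Matrix.mul_diagonal, Matrix.diagonal_mul,
      Matrix.smul_apply, smul_eq_mul, mul_right_comm, ← Units.val_mul, ← zpow_add]
    rcases eq_or_ne (i.val + j.val) 5 with hij | hij
    · congr 4
      fin_cases i <;> fin_cases j <;> simp at hij ⊢
    · simp [form, hij]⟩

/-- The weight lattice: quadruples of half-integers `(λ₁, λ₂, λ₃, λ₄)` such that
`λ₁ - λ₂` and `λ₂ - λ₃` are integers. It is the lattice of coweights of `PGL(2) × PSp(6)`. -/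
def IsWeight (lam : Fin 4 → ℚ) : Prop :=
  (∀ i, ∃ n : ℤ, 2 * lam i = n) ∧
    (∃ n : ℤ, lam 0 - lam 1 = n) ∧ (∃ n : ℤ, lam 1 - lam 2 = n)

/-- `t^(λ₁, λ₂, λ₃)` in `PSp(6, 𝕂)`: the class of
`diag(t^λ₁, t^λ₂, t^λ₃, t^(-λ₃), t^(-λ₂), t^(-λ₁))`. It is defined through the lift to `GSp(6)`
obtained by multiplying this matrix by the scalar `t^λ₃`, so that all exponents are integers when `lam` is
a weight (the floors are then exact). -/
noncomputable def tPSp (lam : Fin 4 → ℚ) : PSp6 𝕂 :=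
  PSp6.mk 𝕂 (tGSp ⌊lam 0 - lam 2⌋ ⌊lam 1 - lam 2⌋ ⌊2 * lam 2⌋)

/-- `t^s` in `PGL(2, 𝕂)` for a half-integer `s`: the class of `diag(t^s, t^(-s))`, that is, of
`diag(t^(2s), 1)`. -/
noncomputable def tPGL (s : ℚ) : PGL(2, 𝕂) :=
  Matrix.ProjGenLinGroup.mk (tDiag ![⌊2 * s⌋, 0])

/-- Relevant weights: `λ₁ ≥ λ₂`, `λ₃ ≥ 0` and `λ₄ ≥ 0`. -/
def IsRelevant (lam : Fin 4 → ℚ) : Prop :=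
  IsWeight lam ∧ lam 1 ≤ lam 0 ∧ 0 ≤ lam 2 ∧ 0 ≤ lam 3

/-- The simple roots of `𝔣(4)` in the coordinates `(ε₁, ε₂, ε₃, δ)`. -/
def simpleRoot : Fin 4 → Fin 4 → ℚ :=
  ![![1/2, -1/2, -1/2, 1/2],
    ![-1/2, 1/2, 1/2, 1/2],
    ![1/2, -1/2, 1/2, -1/2],
    ![0, 1, -1, 0]]

/-- The root order: `μ ≤ λ` if `λ - μ` is a combination of the simple roots with nonnegative
integer coefficients. -/
def RootLE (mu lam : Fin 4 → ℚ) : Prop :=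
  ∃ a : Fin 4 → ℕ, lam - mu = ∑ i, a i • simpleRoot i

/-! ### The orbits -/

/-- The `H(𝕂)`-orbit of the point `(1, t^λ₄ g t^(λ₁, λ₂, λ₃))` of the affine Grassmannian. -/
noncomputable def orbitO (lam : Fin 4 → ℚ) : Set Gr :=
  MulAction.orbit HF (QuotientGroup.mk ((1, iota 𝕂 (tPGL (lam 3)) * g * tPSp lam) : GF) : Gr)

/-- The semi-infinite orbit: the `U_B(𝕂)`-orbit of the point
`(t^(-μ₄), g t^(μ₁, μ₂, μ₃))` of the affine Grassmannian. -/
noncomputable def orbitS (mu : Fin 4 → ℚ) : Set Gr :=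
  MulAction.orbit UBF (QuotientGroup.mk ((tPGL (-(mu 3)), g * tPSp mu) : GF) : Gr)

end GaiottoF4

namespace GaiottoF4

/-! ### Orders of Laurent series -/

/-! The argument is a Mirković–Vilonen style estimate: semi-invariants of `H` on lifts `(Z, X)` to
2×2 and 6×6 matrices are monomials on the semi-infinite orbit and have bounded order on the
`H(𝕂)`-orbit.

Let `(A, M)` lift an element of `H` and act by left multiplication. Three vectors of length two move
by `A`, up to a power of `det A`: the first column `z` of `Z`; the vector `v = (X 4 5, -X 5 5)`,
since `A'` is `A` conjugated by `diag(1, -1)`; and the pair `w` of 3×3 minors with rows `4, 5, i`,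
for `i = 2, 3`, in the last three columns. The determinants of `(v, z)`, `(w, z)` and `(v, w)`,
taken up to sign, together with the lower right 2×2 minor of `X`, are therefore multiplied by `det
A` or its square (`semiinvariant_one` to `semiinvariant_four`).

Triangularity of the unipotent factors makes each function a unit monomial on the semi-infinite
orbit; there `g` keeps both entries of `w` nonzero. On the other orbit each is a monomial times an
integral power series, because `λ₁ - λ₂`, `λ₃` and `λ₄` are nonnegative. Comparing orders gives four
inequalities (`exponent_relations`). They involve the unknown orders of `det A` and of two scalars,
which the determinants of the two lifted equations eliminate. What remains is that the functionals
`δ₁ + δ₄`, `δ₁ + δ₂ + δ₃ + δ₄`, `2δ₁ + δ₂ + δ₃` and `δ₁ + δ₂` are nonnegative on `δ = λ - μ`; this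
is the dual basis of the simple roots. -/

/-- The order of vanishing of an invertible Laurent series. -/
noncomputable def ord : 𝕂ˣ →* Multiplicative ℤ where
  toFun u := Multiplicative.ofAdd (u : 𝕂).order
  map_one' := by simp
  map_mul' u v := by
    rw [Units.val_mul, HahnSeries.order_mul u.ne_zero v.ne_zero, ofAdd_add]

lemma toAdd_ord (u : 𝕂ˣ) : (ord u).toAdd = (u : 𝕂).order := rfl

lemma toAdd_ord_t : (ord t).toAdd = 1 := by
  rw [toAdd_ord, t, Units.val_mk0, HahnSeries.order_single one_ne_zero]

lemma order_algebraMap_nonneg (r : 𝕆) : 0 ≤ (algebraMap 𝕆 𝕂 r).order := by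
  by_cases hr : algebraMap 𝕆 𝕂 r = 0
  · simp [hr]
  by_contra! h
  refine hr (HahnSeries.coeff_order_eq_zero.mp ?_)
  rw [LaurentSeries.coe_algebraMap] at h ⊢
  rw [PowerSeries.coeff_coe, if_pos h]

/-- Since `u` is a unit, the integral cofactor cannot vanish, so its order is a genuine one and not
the default value at `0`. -/
lemma ord_le_of_eq_mul {u v : 𝕂ˣ} {r : 𝕆} (h : (u : 𝕂) = v * algebraMap 𝕆 𝕂 r) :
    (ord v).toAdd ≤ (ord u).toAdd := by
  have hr : algebraMap 𝕆 𝕂 r ≠ 0 := by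
    intro h0
    exact u.ne_zero (by rw [h, h0, mul_zero])
  rw [toAdd_ord, toAdd_ord, h, HahnSeries.order_mul v.ne_zero hr]
  exact le_add_of_nonneg_right (order_algebraMap_nonneg r)

lemma toAdd_ord_map_algebraMap (r : 𝕆ˣ) : (ord (Units.map (algebraMap 𝕆 𝕂) r)).toAdd = 0 := by
  have h1 : 0 ≤ (ord (Units.map (algebraMap 𝕆 𝕂 : 𝕆 →* 𝕂) r)).toAdd := order_algebraMap_nonneg r.val
  have h2 : 0 ≤ (ord (Units.map (algebraMap 𝕆 𝕂 : 𝕆 →* 𝕂) r⁻¹)).toAdd :=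
    order_algebraMap_nonneg r⁻¹.val
  rw [map_inv, map_inv, toAdd_inv] at h2
  exact le_antisymm (by linarith) h1

/-! ### Determinants -/

lemma det_eq_one_of_mem_unipotent {n R : Type*} [Fintype n] [DecidableEq n] [CommRing R]
    {e : n → ℤ} {U : GL n R} (hU : U ∈ unipotent R e) : U.det = 1 := by
  have hT : U.val.BlockTriangular e := by
    intro i j hij
    rw [hU i j hij.le, Matrix.one_apply_ne]
    rintro rfl
    exact lt_irrefl _ hij
  refine Units.ext ?_
  rw [Matrix.GeneralLinearGroup.val_det_apply, hT.det, Units.val_one]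
  refine Finset.prod_eq_one fun a _ => ?_
  have hB : U.val.toSquareBlock e a = 1 := by
    ext i j
    rw [Matrix.toSquareBlock_def, Matrix.of_apply, hU i j (by rw [i.2, j.2]), Matrix.one_apply,
      Matrix.one_apply]
    simp only [Subtype.ext_iff]
  rw [hB, Matrix.det_one]

/-! ### Lifts of elements of `H(𝕂)` -/

/-- The pair `(A, M)` of invertible matrices has the shape of a lift of an element of `H`: the
rows `2, …, 5` of `M` are block upper triangular with the diagonal blocks of `ι(A)`. -/
structure IsHLift (A : GL (Fin 2) 𝕂) (M : GL (Fin 6) 𝕂) : Prop where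
  det : M.det = A.det ^ 3
  lower : ∀ i j : Fin 6, j.val / 2 < i.val / 2 → M.val i j = 0
  diag : ∀ i j : Fin 6, 2 ≤ i.val → i.val / 2 = j.val / 2 → M.val i j = iotaMatrix 𝕂 A.val i j

lemma IsHLift.mul {A B : GL (Fin 2) 𝕂} {M N : GL (Fin 6) 𝕂} (h : IsHLift A M)
    (h' : IsHLift B N) : IsHLift (A * B) (M * N) where
  det := by rw [map_mul, map_mul, h.det, h'.det]; exact (mul_pow A.det B.det 3).symm
  lower i j hij := by
    rw [Units.val_mul, Matrix.mul_apply]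
    refine Finset.sum_eq_zero fun k _ => ?_
    rcases lt_or_ge (k.val / 2) (i.val / 2) with hk | hk
    · rw [h.lower i k hk, zero_mul]
    · rw [h'.lower k j (hij.trans_le hk), mul_zero]
  diag i j hi hij := by
    rw [Units.val_mul, Units.val_mul, map_mul, Matrix.mul_apply, Matrix.mul_apply]
    refine Finset.sum_congr rfl fun k _ => ?_
    rcases lt_trichotomy (k.val / 2) (i.val / 2) with hk | hk | hk
    · have h0 : iotaMatrix 𝕂 A.val i k = 0 := by
        fin_cases i <;> fin_cases k <;> simp [iotaMatrix] at hk ⊢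
      rw [h.lower i k hk, h0, zero_mul, zero_mul]
    · rw [h.diag i k hi hk.symm, h'.diag k j (by omega) (by omega)]
    · have h0 : iotaMatrix 𝕂 B.val k j = 0 := by
        rw [hij] at hk
        fin_cases k <;> fin_cases j <;> simp [iotaMatrix] at hk ⊢
      rw [h'.lower k j (by omega), h0, mul_zero, mul_zero]

lemma det_iotaMatrix {R : Type*} [CommRing R] (A : Matrix (Fin 2) (Fin 2) R) :
    (iotaMatrix R A).det = A.det ^ 3 := by
  rw [Matrix.det_fin_two]
  simp only [iotaMatrix, MonoidHom.coe_mk, OneHom.coe_mk]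
  generalize A 0 0 = a
  generalize A 0 1 = b
  generalize A 1 0 = c
  generalize A 1 1 = d
  simp [Matrix.det_succ_row_zero, Fin.sum_univ_succ, Fin.succAbove]
  ring

lemma isHLift_iotaGL (A : GL (Fin 2) 𝕂) : IsHLift A (iotaGL 𝕂 A).val where
  det := by
    refine Units.ext ?_
    rw [Units.val_pow_eq_pow_val, Matrix.GeneralLinearGroup.val_det_apply,
      Matrix.GeneralLinearGroup.val_det_apply]
    exact det_iotaMatrix A.val
  lower i j hij := by
    change iotaMatrix 𝕂 A.val i j = 0
    fin_cases i <;> fin_cases j <;> simp [iotaMatrix] at hij ⊢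
  diag _ _ _ _ := rfl

lemma isHLift_unipotent {u : GL (Fin 6) 𝕂}
    (hu : u ∈ unipotent 𝕂 fun i : Fin 6 => ((i.val / 2 : ℕ) : ℤ)) : IsHLift 1 u where
  det := by rw [det_eq_one_of_mem_unipotent hu, map_one, one_pow]
  lower i j hij := by
    rw [hu i j (Int.ofNat_le.mpr hij.le), Matrix.one_apply_ne]
    rintro rfl
    exact lt_irrefl _ hij
  diag i j _ hij := by
    rw [hu i j (Int.ofNat_le.mpr hij.ge), Units.val_one, map_one]

lemma exists_isHLift {h : GF} (hh : h ∈ HF) : ∃ (A : GL (Fin 2) 𝕂) (M : GSp6 𝕂),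
    IsHLift A M.val ∧ h = (Matrix.ProjGenLinGroup.mk A, PSp6.mk 𝕂 M) := by
  have key : ∀ x ∈ ((((MonoidHom.id PGL(2, 𝕂)).prod (iota 𝕂)).range : Set GF) ∪
      ((⊥ : Subgroup PGL(2, 𝕂)).prod UF : Subgroup GF)), ∃ (A : GL (Fin 2) 𝕂) (M : GSp6 𝕂),
      IsHLift A M.val ∧ x = (Matrix.ProjGenLinGroup.mk A, PSp6.mk 𝕂 M) := by
    rintro x (⟨a, rfl⟩ | ⟨h1, u, hu, h2⟩)
    · obtain ⟨A, rfl⟩ := Matrix.ProjGenLinGroup.mk_surjective a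
      exact ⟨A, iotaGL 𝕂 A, isHLift_iotaGL A, rfl⟩
    · refine ⟨1, u, isHLift_unipotent hu, Prod.ext ?_ h2.symm⟩
      rw [map_one]
      exact h1
  rw [HF, Subgroup.sup_eq_closure] at hh
  induction hh using Subgroup.closure_induction'' with
  | mem x hx => exact key x hx
  -- The generating set is a union of two subgroups, so inverses of generators are generators and
  -- `IsHLift` need only be stable under products.
  | inv_mem x hx =>
    refine key _ ?_
    rcases hx with hx | hx
    · exact Or.inl (inv_mem hx)
    · exact Or.inr (inv_mem hx)
  | one => exact key 1 (Or.inl (one_mem _))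
  | mul x y _ _ hx hy =>
    obtain ⟨A, M, hM, rfl⟩ := hx
    obtain ⟨B, N, hN, rfl⟩ := hy
    exact ⟨A * B, M * N, hM.mul hN, by rw [map_mul, map_mul]; rfl⟩

/-! ### Lifts of points of the intersection of two orbits -/

lemma PSp6.exists_scalar_of_mk_eq {M N : GSp6 𝕂} (h : PSp6.mk 𝕂 M = PSp6.mk 𝕂 N) :
    ∃ c : 𝕂ˣ, M.val * Matrix.GeneralLinearGroup.scalar (Fin 6) c = N.val := by
  have h' := QuotientGroup.eq.mp h
  rw [Subgroup.mem_subgroupOf, Matrix.GeneralLinearGroup.center_eq_range_scalar] at h'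
  obtain ⟨c, hc⟩ := h'
  refine ⟨c, ?_⟩
  rw [hc]
  simp

/-- Equalities in `PGL(2)` and `PSp(6)` become matrix equalities at the cost of the scalars `c` and
`d`. The symplectic conditions on `M`, `N` and `L` are dropped: triangular shapes, integrality and
determinants suffice. -/
lemma exists_lifts {lam mu : Fin 4 → ℚ} (h : (orbitO lam ∩ orbitS mu).Nonempty) :
    ∃ (A U : GL (Fin 2) 𝕂) (M N : GL (Fin 6) 𝕂) (K : GL (Fin 2) 𝕆) (L : GL (Fin 6) 𝕆) (c d : 𝕂ˣ),
      IsHLift A M ∧ U ∈ unipotent 𝕂 (fun i : Fin 2 => (i.val : ℤ)) ∧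
      N ∈ unipotent 𝕂 (fun i : Fin 6 => -(i.val : ℤ)) ∧
      U * tDiag ![⌊2 * -(mu 3)⌋, 0] * Matrix.GeneralLinearGroup.scalar (Fin 2) c =
        A * Matrix.GeneralLinearGroup.map (algebraMap 𝕆 𝕂) K ∧
      gGSp.val * N * (tGSp ⌊mu 0 - mu 2⌋ ⌊mu 1 - mu 2⌋ ⌊2 * mu 2⌋).val *
          Matrix.GeneralLinearGroup.scalar (Fin 6) d =
        M * ((iotaGL 𝕂 (tDiag ![⌊2 * lam 3⌋, 0])).val * gGSp.val *
          (tGSp ⌊lam 0 - lam 2⌋ ⌊lam 1 - lam 2⌋ ⌊2 * lam 2⌋).val *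
          Matrix.GeneralLinearGroup.map (algebraMap 𝕆 𝕂) L) := by
  obtain ⟨x, ⟨⟨x₁, hx₁⟩, rfl⟩, ⟨⟨x₂, hx₂⟩, hx⟩⟩ := h
  obtain ⟨A, M, hM, rfl⟩ := exists_isHLift hx₁
  obtain ⟨k, hk, hxk⟩ : ∃ k ∈ PGL2O.prod PSp6O, x₂ * (tPGL (-(mu 3)), g * tPSp mu) =
      (Matrix.ProjGenLinGroup.mk A, PSp6.mk 𝕂 M) *
        (1, iota 𝕂 (tPGL (lam 3)) * g * tPSp lam) * k :=
    ⟨_, QuotientGroup.eq.mp hx.symm, (mul_inv_cancel_left _ _).symm⟩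
  clear hx
  obtain ⟨u₁, u₂⟩ := x₂
  obtain ⟨k₁, k₂⟩ := k
  obtain ⟨⟨U, hU, rfl⟩, ⟨_, ⟨N, hN, rfl⟩, rfl⟩⟩ := hx₂
  obtain ⟨⟨_, ⟨K, rfl⟩, rfl⟩, ⟨L', ⟨L, _, hL⟩, rfl⟩⟩ := hk
  obtain ⟨hk₁, hk₂⟩ := Prod.ext_iff.mp hxk
  obtain ⟨c, hc⟩ := Matrix.ProjGenLinGroup.mk_eq_mk_iff.mp
    (show Matrix.ProjGenLinGroup.mk (U * tDiag ![⌊2 * -(mu 3)⌋, 0]) =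
      Matrix.ProjGenLinGroup.mk (A * Matrix.GeneralLinearGroup.map (algebraMap 𝕆 𝕂) K) by
        rw [map_mul, map_mul]
        exact hk₁.trans (by simp))
  obtain ⟨d, hd⟩ := PSp6.exists_scalar_of_mk_eq
    (show PSp6.mk 𝕂 (gGSp * N * tGSp ⌊mu 0 - mu 2⌋ ⌊mu 1 - mu 2⌋ ⌊2 * mu 2⌋) =
      PSp6.mk 𝕂 (M * (iotaGL 𝕂 (tDiag ![⌊2 * lam 3⌋, 0]) * gGSp *
        tGSp ⌊lam 0 - lam 2⌋ ⌊lam 1 - lam 2⌋ ⌊2 * lam 2⌋ * L')) by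
        -- The unipotent group is conjugated by `g` and the base point starts with `g`, so `g⁻¹ * g`
        -- cancels.
        have h₁ : PSp6.mk 𝕂 (gGSp * N * tGSp ⌊mu 0 - mu 2⌋ ⌊mu 1 - mu 2⌋ ⌊2 * mu 2⌋) =
            g * PSp6.mk 𝕂 N * g⁻¹ * (g * tPSp mu) := by
          rw [map_mul, map_mul, mul_assoc _ g⁻¹, inv_mul_cancel_left]
          rfl
        rw [h₁]
        refine hk₂.trans ?_
        rw [map_mul, map_mul, map_mul, map_mul, ← mul_assoc]
        rfl)
  refine ⟨A, U, M, N, K, L, c, d, hM, hU, hN, hc, ?_⟩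
  have hL' : Matrix.GeneralLinearGroup.map (algebraMap 𝕆 𝕂) L = L'.val := hL
  rw [hL']
  exact hd

/-! ### Entries of the lifts -/

lemma tDiag_mul_apply {n : ℕ} (e : Fin n → ℤ) (M : Matrix (Fin n) (Fin n) 𝕂) (i j : Fin n) :
    ((tDiag e).val * M) i j = ((t ^ e i : 𝕂ˣ) : 𝕂) * M i j :=
  Matrix.diagonal_mul _ _ _ _

lemma mul_tDiag_apply {n : ℕ} (e : Fin n → ℤ) (M : Matrix (Fin n) (Fin n) 𝕂) (i j : Fin n) :
    (M * (tDiag e).val) i j = M i j * ((t ^ e j : 𝕂ˣ) : 𝕂) :=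
  Matrix.mul_diagonal _ _ _ _

lemma mul_scalar_apply {n : ℕ} (c : 𝕂ˣ) (M : Matrix (Fin n) (Fin n) 𝕂) (i j : Fin n) :
    (M * (Matrix.GeneralLinearGroup.scalar (Fin n) c).val) i j = M i j * c := by
  rw [Matrix.GeneralLinearGroup.coe_scalar, Matrix.scalar_apply, Matrix.mul_diagonal]

lemma gGSp_mul_apply (M : Matrix (Fin 6) (Fin 6) 𝕂) (i j : Fin 6) :
    (gGSp.val.val * M) i j = M i j + if i = 2 then M 3 j else 0 := by
  change ((Matrix.transvection 2 3 1 : Matrix (Fin 6) (Fin 6) 𝕂) * M) i j = _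
  split_ifs with h
  · subst h
    simp
  · simp [h]

lemma ord_det_tDiag {n : ℕ} (e : Fin n → ℤ) : (ord (tDiag e).det).toAdd = ∑ i, e i := by
  have h : (tDiag e).det = ∏ i, t ^ e i := by
    refine Units.ext ?_
    rw [Matrix.GeneralLinearGroup.val_det_apply, Units.coe_prod]
    exact Matrix.det_diagonal
  rw [h, map_prod, toAdd_prod]
  refine Finset.sum_congr rfl fun i _ => ?_
  rw [map_zpow, toAdd_zpow, toAdd_ord_t, smul_eq_mul, mul_one]

lemma ord_det_scalar {n : ℕ} (c : 𝕂ˣ) :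
    (ord (Matrix.GeneralLinearGroup.scalar (Fin n) c).det).toAdd = n * (ord c).toAdd := by
  have h : (Matrix.GeneralLinearGroup.scalar (Fin n) c).det = c ^ n := by
    refine Units.ext ?_
    simp
  rw [h, map_pow, toAdd_pow, nsmul_eq_mul]

lemma ord_det_map {n : ℕ} (K : GL (Fin n) 𝕆) :
    (ord (Matrix.GeneralLinearGroup.map (algebraMap 𝕆 𝕂) K).det).toAdd = 0 := by
  rw [Matrix.GeneralLinearGroup.map_det]
  exact toAdd_ord_map_algebraMap _

lemma det_gGSp : gGSp.val.det = 1 := by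
  refine Units.ext ?_
  rw [Matrix.GeneralLinearGroup.val_det_apply]
  exact Matrix.det_transvection_of_ne 2 3 (by decide) 1

lemma exists_algebraMap_zpow {n : ℤ} (hn : 0 ≤ n) :
    ∃ r : 𝕆, ((t ^ n : 𝕂ˣ) : 𝕂) = algebraMap 𝕆 𝕂 r := by
  lift n to ℕ using hn
  refine ⟨PowerSeries.X ^ n, ?_⟩
  rw [zpow_natCast, Units.val_pow_eq_pow_val, map_pow, LaurentSeries.coe_algebraMap,
    HahnSeries.ofPowerSeries_X]
  rfl

lemma iotaMatrix_mul_apply {R : Type*} [CommRing R] (A : Matrix (Fin 2) (Fin 2) R)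
    (M : Matrix (Fin 6) (Fin 6) R) (j : Fin 6) :
    (iotaMatrix R A * M) 2 j = A 0 0 * M 2 j + A 0 1 * M 3 j ∧
    (iotaMatrix R A * M) 3 j = A 1 0 * M 2 j + A 1 1 * M 3 j ∧
    (iotaMatrix R A * M) 4 j = A 0 0 * M 4 j - A 0 1 * M 5 j ∧
    (iotaMatrix R A * M) 5 j = -(A 1 0 * M 4 j) + A 1 1 * M 5 j := by
  refine ⟨?_, ?_, ?_, ?_⟩ <;>
    simp [iotaMatrix, Matrix.mul_apply, Fin.sum_univ_six, sub_eq_add_neg]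

lemma IsHLift.mul_apply {A : GL (Fin 2) 𝕂} {M : GL (Fin 6) 𝕂} (h : IsHLift A M)
    (Y : Matrix (Fin 6) (Fin 6) 𝕂) (j : Fin 6) :
    (M.val * Y) 2 j = A.val 0 0 * Y 2 j + A.val 0 1 * Y 3 j + M.val 2 4 * Y 4 j +
      M.val 2 5 * Y 5 j ∧
    (M.val * Y) 3 j = A.val 1 0 * Y 2 j + A.val 1 1 * Y 3 j + M.val 3 4 * Y 4 j +
      M.val 3 5 * Y 5 j ∧
    (M.val * Y) 4 j = A.val 0 0 * Y 4 j - A.val 0 1 * Y 5 j ∧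
    (M.val * Y) 5 j = -(A.val 1 0 * Y 4 j) + A.val 1 1 * Y 5 j := by
  have hl := h.lower
  have hd := h.diag
  refine ⟨?_, ?_, ?_, ?_⟩
  · rw [Matrix.mul_apply, Fin.sum_univ_six, hl 2 0 (by decide), hl 2 1 (by decide),
      hd 2 2 (by decide) rfl, hd 2 3 (by decide) rfl]
    simp [iotaMatrix]
  · rw [Matrix.mul_apply, Fin.sum_univ_six, hl 3 0 (by decide), hl 3 1 (by decide),
      hd 3 2 (by decide) rfl, hd 3 3 (by decide) rfl]
    simp [iotaMatrix]
  · rw [Matrix.mul_apply, Fin.sum_univ_six, hl 4 0 (by decide), hl 4 1 (by decide),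
      hl 4 2 (by decide), hl 4 3 (by decide), hd 4 4 (by decide) rfl, hd 4 5 (by decide) rfl]
    simp [iotaMatrix]
    ring
  · rw [Matrix.mul_apply, Fin.sum_univ_six, hl 5 0 (by decide), hl 5 1 (by decide),
      hl 5 2 (by decide), hl 5 3 (by decide), hd 5 4 (by decide) rfl, hd 5 5 (by decide) rfl]
    simp [iotaMatrix]
    ring

/-- The factor `g` adds row `3` to row `2` after the torus has scaled the rows; only the rows seen
by the semi-invariants are recorded. -/
lemma representative_apply (s p q m : ℤ) (L : Matrix (Fin 6) (Fin 6) 𝕂) (j : Fin 6) :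
    let Y := (iotaGL 𝕂 (tDiag ![s, 0])).val.val * gGSp.val.val * (tGSp p q m).val.val * L
    Y 2 j = ((t ^ s : 𝕂ˣ) : 𝕂) * (((t ^ m : 𝕂ˣ) : 𝕂) * L 2 j + L 3 j) ∧
    Y 3 j = L 3 j ∧
    Y 4 j = ((t ^ s : 𝕂ˣ) : 𝕂) * (((t ^ (-q) : 𝕂ˣ) : 𝕂) * L 4 j) ∧
    Y 5 j = ((t ^ (-p) : 𝕂ˣ) : 𝕂) * L 5 j := by
  intro Y
  have hY : Y = iotaMatrix 𝕂 (tDiag ![s, 0]).val *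
      (gGSp.val.val * ((tDiag ![p + m, q + m, m, 0, -q, -p]).val * L)) := by
    rw [← Matrix.mul_assoc, ← Matrix.mul_assoc]
    rfl
  have h00 : (tDiag ![s, 0]).val 0 0 = ((t ^ s : 𝕂ˣ) : 𝕂) := Matrix.diagonal_apply_eq _ _
  have h11 : (tDiag ![s, 0]).val 1 1 = (1 : 𝕂) := Matrix.diagonal_apply_eq _ _
  have h01 : (tDiag ![s, 0]).val 0 1 = (0 : 𝕂) := Matrix.diagonal_apply_ne _ (by decide)
  have h10 : (tDiag ![s, 0]).val 1 0 = (0 : 𝕂) := Matrix.diagonal_apply_ne _ (by decide)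
  obtain ⟨h2, h3, h4, h5⟩ := iotaMatrix_mul_apply (tDiag ![s, 0]).val
    (gGSp.val.val * ((tDiag ![p + m, q + m, m, 0, -q, -p]).val * L)) j
  rw [hY, h2, h3, h4, h5, h00, h11, h01, h10]
  simp only [gGSp_mul_apply, tDiag_mul_apply]
  simp

/-- `N` is lower triangular with unit diagonal, and `g` adds row `3` to row `2`. In the last three
columns these two rows thus agree, which makes the two values of `minorThree` equal and nonzero. -/
lemma semiinfinite_apply {N : GL (Fin 6) 𝕂} (hN : N ∈ unipotent 𝕂 fun i : Fin 6 => -(i.val : ℤ))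
    (p q m : ℤ) (d : 𝕂ˣ) :
    let X := gGSp.val.val * N.val * (tGSp p q m).val.val *
      (Matrix.GeneralLinearGroup.scalar (Fin 6) d).val
    X 2 3 = d ∧ X 2 4 = 0 ∧ X 2 5 = 0 ∧ X 3 3 = d ∧ X 3 4 = 0 ∧ X 3 5 = 0 ∧
      X 4 4 = ((t ^ (-q) * d : 𝕂ˣ) : 𝕂) ∧ X 4 5 = 0 ∧ X 5 5 = ((t ^ (-p) * d : 𝕂ˣ) : 𝕂) := by
  intro X
  have hX : ∀ i j, X i j = (gGSp.val.val * N.val) i j *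
      ((t ^ (![p + m, q + m, m, 0, -q, -p] : Fin 6 → ℤ) j : 𝕂ˣ) : 𝕂) * d := by
    intro i j
    rw [← mul_tDiag_apply, ← mul_scalar_apply]
    rfl
  have h1 : ∀ i, N.val i i = 1 := fun i => by rw [hN i i le_rfl, Matrix.one_apply_eq]
  have h0 : ∀ i j, i < j → N.val i j = 0 := fun i j hij => by
    rw [hN i j (neg_le_neg (Int.ofNat_le.mpr hij.le)), Matrix.one_apply_ne hij.ne]
  simp only [hX, gGSp_mul_apply, h1]
  rw [h0 2 3 (by decide), h0 2 4 (by decide), h0 2 5 (by decide), h0 3 4 (by decide),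
    h0 3 5 (by decide), h0 4 5 (by decide)]
  simp

/-- The `3 × 3` minor with rows `4, 5, i` and columns `4, 5, 3`. -/
def minorThree {R : Type*} [CommRing R] (X : Matrix (Fin 6) (Fin 6) R) (i : Fin 6) : R :=
  X i 3 * (X 4 4 * X 5 5 - X 4 5 * X 5 4) - X i 4 * (X 4 3 * X 5 5 - X 4 5 * X 5 3) +
    X i 5 * (X 4 3 * X 5 4 - X 4 4 * X 5 3)

/-! ### Semi-invariants of `H` on pairs of matrices -/

section SemiInvariants

variable {A : GL (Fin 2) 𝕂} {M : GL (Fin 6) 𝕂}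

lemma semiinvariant_two (h : IsHLift A M) (Y : Matrix (Fin 6) (Fin 6) 𝕂) :
    (M.val * Y) 4 4 * (M.val * Y) 5 5 - (M.val * Y) 4 5 * (M.val * Y) 5 4 =
      A.det * (Y 4 4 * Y 5 5 - Y 4 5 * Y 5 4) := by
  rw [Matrix.GeneralLinearGroup.val_det_apply, Matrix.det_fin_two]
  simp only [h.mul_apply]
  ring

/-- Up to sign, this is the determinant of `(v, z)`, two vectors on which `H` acts through `A`. -/
lemma semiinvariant_one (h : IsHLift A M) (Y : Matrix (Fin 6) (Fin 6) 𝕂)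
    (Z : Matrix (Fin 2) (Fin 2) 𝕂) :
    (M.val * Y) 4 5 * (A.val * Z) 1 0 + (M.val * Y) 5 5 * (A.val * Z) 0 0 =
      A.det * (Y 4 5 * Z 1 0 + Y 5 5 * Z 0 0) := by
  rw [Matrix.GeneralLinearGroup.val_det_apply, Matrix.det_fin_two]
  simp only [h.mul_apply, Matrix.mul_apply, Fin.sum_univ_two]
  ring

/-- The unipotent part adds multiples of rows `4, 5` to rows `2, 3`, which does not affect a minor
containing rows `4, 5`. Those two rows contribute `det A' = det A`, and the remaining row index
moves by `A`. -/
lemma minorThree_mul (h : IsHLift A M) (Y : Matrix (Fin 6) (Fin 6) 𝕂) :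
    minorThree (M.val * Y) 2 =
      A.det * (A.val 0 0 * minorThree Y 2 + A.val 0 1 * minorThree Y 3) ∧
    minorThree (M.val * Y) 3 =
      A.det * (A.val 1 0 * minorThree Y 2 + A.val 1 1 * minorThree Y 3) := by
  rw [Matrix.GeneralLinearGroup.val_det_apply, Matrix.det_fin_two]
  simp only [minorThree, h.mul_apply]
  constructor <;> ring

lemma semiinvariant_three (h : IsHLift A M) (Y : Matrix (Fin 6) (Fin 6) 𝕂)
    (Z : Matrix (Fin 2) (Fin 2) 𝕂) :
    minorThree (M.val * Y) 2 * (A.val * Z) 1 0 - minorThree (M.val * Y) 3 * (A.val * Z) 0 0 =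
      A.det ^ 2 * (minorThree Y 2 * Z 1 0 - minorThree Y 3 * Z 0 0) := by
  rw [(minorThree_mul h Y).1, (minorThree_mul h Y).2, Matrix.GeneralLinearGroup.val_det_apply,
    Matrix.det_fin_two]
  simp only [Matrix.mul_apply, Fin.sum_univ_two]
  ring

lemma semiinvariant_four (h : IsHLift A M) (Y : Matrix (Fin 6) (Fin 6) 𝕂) :
    (M.val * Y) 4 5 * minorThree (M.val * Y) 3 + (M.val * Y) 5 5 * minorThree (M.val * Y) 2 =
      A.det ^ 2 * (Y 4 5 * minorThree Y 3 + Y 5 5 * minorThree Y 2) := by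
  rw [(minorThree_mul h Y).1, (minorThree_mul h Y).2, Matrix.GeneralLinearGroup.val_det_apply,
    Matrix.det_fin_two]
  simp only [h.mul_apply]
  ring

end SemiInvariants

/-! ### The inequalities -/

/-- The conditions on the exponents of the representatives of two orbits that meet; `a`, `c` and
`d` are the orders of the determinant of the lift to `GL(2)` of an element of `H` and of two
scalars. -/
lemma exponent_relations {A U : GL (Fin 2) 𝕂} {M N : GL (Fin 6) 𝕂} {K : GL (Fin 2) 𝕆}
    {L : GL (Fin 6) 𝕆} {c d : 𝕂ˣ} {p q m s p' q' m' s' : ℤ} (hqp : q ≤ p) (hm : 0 ≤ m)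
    (hs : 0 ≤ s) (hM : IsHLift A M) (hU : U ∈ unipotent 𝕂 (fun i : Fin 2 => (i.val : ℤ)))
    (hN : N ∈ unipotent 𝕂 (fun i : Fin 6 => -(i.val : ℤ)))
    (h2 : U * tDiag ![s', 0] * Matrix.GeneralLinearGroup.scalar (Fin 2) c =
      A * Matrix.GeneralLinearGroup.map (algebraMap 𝕆 𝕂) K)
    (h6 : gGSp.val * N * (tGSp p' q' m').val * Matrix.GeneralLinearGroup.scalar (Fin 6) d =
      M * ((iotaGL 𝕂 (tDiag ![s, 0])).val * gGSp.val * (tGSp p q m).val *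
        Matrix.GeneralLinearGroup.map (algebraMap 𝕆 𝕂) L)) :
    ∃ a c d : ℤ, s' + 2 * c = a ∧ m' + 2 * d = a + s + m ∧ a - p ≤ s' - p' + c + d ∧
      a + s - p - q ≤ -p' - q' + 2 * d ∧ 2 * a + s - p - q ≤ s' - p' - q' + c + 3 * d ∧
      2 * a + 2 * s - 2 * p - q ≤ -2 * p' - q' + 4 * d := by
  refine ⟨(ord A.det).toAdd, (ord c).toAdd, (ord d).toAdd, ?_⟩
  have ht : ∀ n : ℤ, (ord (t ^ n)).toAdd = n := fun n => by
    rw [map_zpow, toAdd_zpow, toAdd_ord_t, smul_eq_mul, mul_one]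
  have hd2 := congrArg (fun B => (ord B.det).toAdd) h2
  have hd6 := congrArg (fun B => (ord B.det).toAdd) h6
  have hdet (p q m : ℤ) : (ord (tGSp p q m).val.det).toAdd = 3 * m := by
    rw [tGSp, ord_det_tDiag, Fin.sum_univ_six]
    simp
    ring
  have hdet2 (s : ℤ) : (ord (tDiag ![s, 0]).det).toAdd = s := by
    rw [ord_det_tDiag, Fin.sum_univ_two]
    simp
  -- In rank six every term is a multiple of three; dividing by it gives the relation between
  -- similitude factors.
  simp only [map_mul, toAdd_mul, det_eq_one_of_mem_unipotent hU, det_eq_one_of_mem_unipotent hN,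
    map_one, toAdd_one, ord_det_scalar, ord_det_map, hdet2, hdet, det_gGSp, hM.det,
    (isHLift_iotaGL _).det, map_pow, toAdd_pow] at hd2 hd6
  -- Relevance of `λ` enters only here: `t ^ s`, `t ^ m` and `t ^ (p - q)` are integral and can be
  -- absorbed in the power series cofactors below.
  obtain ⟨S, hS⟩ := exists_algebraMap_zpow hs
  obtain ⟨T, hT⟩ := exists_algebraMap_zpow hm
  obtain ⟨E, hE⟩ := exists_algebraMap_zpow (sub_nonneg.mpr hqp)
  have hq : ((t ^ (-q) : 𝕂ˣ) : 𝕂) = ((t ^ (-p) : 𝕂ˣ) : 𝕂) * algebraMap 𝕆 𝕂 E := by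
    rw [← hE, ← Units.val_mul, ← zpow_add]
    congr 2
    ring
  set f := algebraMap 𝕆 𝕂
  set Y := ((iotaGL 𝕂 (tDiag ![s, 0])).val.val * gGSp.val.val * (tGSp p q m).val.val *
    (Matrix.GeneralLinearGroup.map f L).val) with hY
  set X := gGSp.val.val * N.val * (tGSp p' q' m').val.val *
    (Matrix.GeneralLinearGroup.scalar (Fin 6) d).val with hX
  set Z := (Matrix.GeneralLinearGroup.map f K).val
  set W := U.val * (tDiag ![s', 0]).val * (Matrix.GeneralLinearGroup.scalar (Fin 2) c).val with hW
  have hXY : M.val * Y = X := (congrArg Units.val h6).symm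
  have hWZ : A.val * Z = W := (congrArg Units.val h2).symm
  have hLf : ∀ i j, (Matrix.GeneralLinearGroup.map f L).val i j = f (L.val i j) := fun _ _ => rfl
  have hKf : ∀ i j, Z i j = f (K.val i j) := fun _ _ => rfl
  obtain ⟨hX23, hX24, hX25, hX33, hX34, hX35, hX44, hX45, hX55⟩ := semiinfinite_apply hN p' q' m' d
  rw [← hX] at hX23 hX24 hX25 hX33 hX34 hX35 hX44 hX45 hX55
  have hW0 : W 0 0 = ((t ^ s' * c : 𝕂ˣ) : 𝕂) ∧ W 1 0 = 0 := by
    rw [hW, mul_scalar_apply, mul_scalar_apply, mul_tDiag_apply, mul_tDiag_apply,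
      hU 0 0 le_rfl, hU 1 0 (by decide)]
    simp
  have hYj : ∀ j, _ := fun j => representative_apply s p q m
    (Matrix.GeneralLinearGroup.map f L).val j
  rw [← hY] at hYj
  have i1 : ((t ^ (-p') * d * (t ^ s' * c) : 𝕂ˣ) : 𝕂) = ((A.det * t ^ (-p) : 𝕂ˣ) : 𝕂) *
      f (S * E * L.val 4 5 * K.val 1 0 + L.val 5 5 * K.val 0 0) := by
    have h := semiinvariant_one hM Y Z
    rw [hXY, hWZ, hX45, hX55, hW0.1, hW0.2, (hYj 5).2.2.1, (hYj 5).2.2.2, hLf, hLf, hKf, hKf,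
      hS, hq] at h
    simp only [Units.val_mul, map_add, map_mul] at h ⊢
    linear_combination h
  have i2 : ((t ^ (-q') * d * (t ^ (-p') * d) : 𝕂ˣ) : 𝕂) =
      ((A.det * (t ^ s * t ^ (-p) * t ^ (-q)) : 𝕂ˣ) : 𝕂) *
      f (L.val 4 4 * L.val 5 5 - L.val 4 5 * L.val 5 4) := by
    have h := semiinvariant_two hM Y
    rw [hXY, hX44, hX45, hX55, (hYj 4).2.2.1, (hYj 4).2.2.2, (hYj 5).2.2.1, (hYj 5).2.2.2, hLf,
      hLf, hLf, hLf] at h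
    simp only [Units.val_mul, map_sub, map_mul] at h ⊢
    linear_combination h
  have hX2 : minorThree X 2 = ((d * (t ^ (-q') * d * (t ^ (-p') * d)) : 𝕂ˣ) : 𝕂) := by
    rw [minorThree, hX23, hX24, hX25, hX44, hX45, hX55, Units.val_mul d, Units.val_mul (_ * d)]
    ring
  have hX3 : minorThree X 3 = ((d * (t ^ (-q') * d * (t ^ (-p') * d)) : 𝕂ˣ) : 𝕂) := by
    rw [minorThree, hX33, hX34, hX35, hX44, hX45, hX55, Units.val_mul d, Units.val_mul (_ * d)]
    ring
  have hY2 : minorThree Y 2 = ((t ^ s * (t ^ s * t ^ (-p) * t ^ (-q)) : 𝕂ˣ) : 𝕂) *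
      f (T * minorThree L.val 2 + minorThree L.val 3) := by
    simp only [minorThree, hYj, hLf, hT, map_add, map_sub, map_mul, Units.val_mul]
    ring
  have hY3 : minorThree Y 3 = ((t ^ s * t ^ (-p) * t ^ (-q) : 𝕂ˣ) : 𝕂) *
      f (minorThree L.val 3) := by
    simp only [minorThree, hYj, hLf, map_add, map_sub, map_mul, Units.val_mul]
    ring
  -- `minorThree Y 2` carries one more factor `t ^ s` than `minorThree Y 3`; only the common
  -- monomial is pulled out, and the excess is the integral `S`.
  have i3 : ((d * (t ^ (-q') * d * (t ^ (-p') * d)) * (t ^ s' * c) : 𝕂ˣ) : 𝕂) =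
      ((A.det ^ 2 * (t ^ s * t ^ (-p) * t ^ (-q)) : 𝕂ˣ) : 𝕂) *
      f (minorThree L.val 3 * K.val 0 0 -
        S * (T * minorThree L.val 2 + minorThree L.val 3) * K.val 1 0) := by
    have h := semiinvariant_three hM Y Z
    rw [hXY, hWZ, hX3, hW0.1, hW0.2, hY2, hY3, hKf, hKf] at h
    simp only [Units.val_mul, Units.val_pow_eq_pow_val, map_add, map_sub, map_mul, ← hS] at h ⊢
    linear_combination -h
  have i4 : ((t ^ (-p') * d * (d * (t ^ (-q') * d * (t ^ (-p') * d))) : 𝕂ˣ) : 𝕂) =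
      ((A.det ^ 2 * (t ^ s * (t ^ s * t ^ (-p) * t ^ (-q)) * t ^ (-p)) : 𝕂ˣ) : 𝕂) *
      f (E * L.val 4 5 * minorThree L.val 3 +
        L.val 5 5 * (T * minorThree L.val 2 + minorThree L.val 3)) := by
    have h := semiinvariant_four hM Y
    rw [hXY, hX2, hX45, hX55, hY2, hY3, (hYj 5).2.2.1, (hYj 5).2.2.2, hLf, hLf] at h
    simp only [Units.val_mul, Units.val_pow_eq_pow_val, map_add, map_mul, hq] at h ⊢
    linear_combination h
  have j1 := ord_le_of_eq_mul i1
  have j2 := ord_le_of_eq_mul i2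
  have j3 := ord_le_of_eq_mul i3
  have j4 := ord_le_of_eq_mul i4
  simp only [map_mul, map_pow, toAdd_mul, toAdd_pow, ht, nsmul_eq_mul, Nat.cast_ofNat] at hd2 hd6 j1 j2 j3 j4
  refine ⟨?_, ?_, ?_, ?_, ?_, ?_⟩ <;> linarith

end GaiottoF4

/-! ### Coefficients of `λ - μ` in the simple roots -/

theorem mainTheorem11 (lam mu : Fin 4 → ℚ)
    (hlam : GaiottoF4.IsRelevant lam) (hmu : GaiottoF4.IsWeight mu)
    (h : (GaiottoF4.orbitO lam ∩ GaiottoF4.orbitS mu).Nonempty) :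
    GaiottoF4.RootLE mu lam := by
  obtain ⟨A, U, M, N, K, L, c, d, hM, hU, hN, h2, h6⟩ := GaiottoF4.exists_lifts h
  obtain ⟨⟨hl, ⟨x, hx⟩, y, hy⟩, hl01, hl2, hl3⟩ := hlam
  obtain ⟨hm, ⟨x', hx'⟩, y', hy'⟩ := hmu
  obtain ⟨m, hm0⟩ := hl 2
  obtain ⟨s, hs0⟩ := hl 3
  obtain ⟨m', hm'0⟩ := hm 2
  obtain ⟨s', hs'0⟩ := hm 3
  have e1 : ⌊lam 0 - lam 2⌋ = x + y := by
    rw [show lam 0 - lam 2 = ((x + y : ℤ) : ℚ) by push_cast; linarith, Int.floor_intCast]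
  have e2 : ⌊lam 1 - lam 2⌋ = y := by rw [hy, Int.floor_intCast]
  have e3 : ⌊2 * lam 2⌋ = m := by rw [hm0, Int.floor_intCast]
  have e4 : ⌊2 * lam 3⌋ = s := by rw [hs0, Int.floor_intCast]
  have e1' : ⌊mu 0 - mu 2⌋ = x' + y' := by
    rw [show mu 0 - mu 2 = ((x' + y' : ℤ) : ℚ) by push_cast; linarith, Int.floor_intCast]
  have e2' : ⌊mu 1 - mu 2⌋ = y' := by rw [hy', Int.floor_intCast]
  have e3' : ⌊2 * mu 2⌋ = m' := by rw [hm'0, Int.floor_intCast]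
  have e4' : ⌊2 * -(mu 3)⌋ = -s' := by
    rw [show 2 * -(mu 3) = ((-s' : ℤ) : ℚ) by push_cast; linarith, Int.floor_intCast]
  rw [e4'] at h2
  rw [e1, e2, e3, e4, e1', e2', e3'] at h6
  have hx0 : 0 ≤ x := by
    have : (0 : ℚ) ≤ x := by linarith
    exact_mod_cast this
  have hm1 : 0 ≤ m := by
    have : (0 : ℚ) ≤ m := by linarith
    exact_mod_cast this
  have hs1 : 0 ≤ s := by
    have : (0 : ℚ) ≤ s := by linarith
    exact_mod_cast this
  obtain ⟨a, c, d, r2, r6, i1, i2, i3, i4⟩ := GaiottoF4.exponent_relations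
    (le_add_of_nonneg_left hx0) hm1 hs1 hM hU hN h2 h6
  obtain ⟨b1, hb1⟩ := Int.eq_ofNat_of_zero_le (sub_nonneg.mpr i1)
  obtain ⟨b2, hb2⟩ := Int.eq_ofNat_of_zero_le (sub_nonneg.mpr i2)
  obtain ⟨b3, hb3⟩ := Int.eq_ofNat_of_zero_le (sub_nonneg.mpr i3)
  obtain ⟨b4, hb4⟩ := Int.eq_ofNat_of_zero_le (sub_nonneg.mpr i4)
  have r2' := congrArg (Int.cast : ℤ → ℚ) r2
  have r6' := congrArg (Int.cast : ℤ → ℚ) r6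
  have hb1' := congrArg (Int.cast : ℤ → ℚ) hb1
  have hb2' := congrArg (Int.cast : ℤ → ℚ) hb2
  have hb3' := congrArg (Int.cast : ℤ → ℚ) hb3
  have hb4' := congrArg (Int.cast : ℤ → ℚ) hb4
  push_cast at r2' r6' hb1' hb2' hb3' hb4'
  -- The slacks of the four inequalities are the coefficients themselves: the 2×2 minor measures
  -- `α₄`, and the determinants of `(v, z)`, `(w, z)`, `(v, w)` measure `α₁`, `α₂`, `α₃`.
  refine ⟨![b1, b3, b4, b2], ?_⟩
  ext i
  fin_cases i <;> simp [Fin.sum_univ_four, GaiottoF4.simpleRoot] <;> linarith
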